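/- Let $0=s_0<s_1<\dots<s_N<D$ ($N\ge 0$), $E_0,\dots,E_N\ge 0$, $a,b\ge 0$, $T_e<T_c$, and put $T_\delta=T_c-T_e$. Call a nonnegative measurable function $P$ on $[0,D]$ *feasible* if, for all $t\in[0,D]$, $$\int_0^t a e^{b\tau}P(\tau)\,d\tau\le T_\delta e^{bt}\qquad\text{and}\qquad \int_0^t P(\tau)\,d\tau\le \sum_{i:\,s_i<t}E_i ,$$ and *optimal* if it is feasible and maximizes $\int_0^D\frac12\log_2(1+P(\tau))\,d\tau$ over all feasible functions. Let $P$ be optimal, and let $$T(t)=e^{-bt}\Big(\int_0^t e^{b\tau}\big(aP(\tau)+bT_e\big)\,d\tau+T_e\Big)$$ be the resulting temperature, i.e. the solution of $T'=aP-b(T-T_e)$ with $T(0)=T_e$. Then, after modification on a null set (which does not affect optimality or $T$), $P$ has the following property: if $P$, as a function on $[0,D]$, is discontinuous at $t\in[0,D]$, then $t=s_k$ is an energy arrival instant for some $k\in\{1,\dots,N\}$, and $P$ has a positive jump there, i.e. finite one-sided limits $P(t^-)<P(t^+)$ exist and $P(t^-)\le P(t)\le P(t^+)$. Moreover, $T$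 is continuous on $[0,D]$. -/

import Mathlib

open Set Filter Topology MeasureTheory

/-- The data of an energy harvesting transmitter that heats up: besides the initial energy `E 0`,
available at time `s 0 = 0`, there are `N` energy arrivals in amounts `E 1, …, E N` at the instants
`s 1 < ⋯ < s N` before the deadline `D`; `a` and `b` are the constants of the thermal model,
`Te` is the temperature of the environment and `Tc` the critical temperature. -/
structure HeatingTransmitter where
  /-- number of energy arrivals after time zero -/
  N : ℕ
  /-- energy arrival instants -/
  s : Fin (N + 1) → ℝ
  /-- amounts of energy -/
  E : Fin (N + 1) → ℝ
  /-- deadline -/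
  D : ℝ
  /-- heating coefficient -/
  a : ℝ
  /-- cooling coefficient -/
  b : ℝ
  /-- temperature of the environment -/
  Te : ℝ
  /-- critical temperature -/
  Tc : ℝ
  s_zero : s 0 = 0
  s_strictMono : StrictMono s
  s_lt_D : ∀ k, s k < D
  E_nonneg : ∀ k, 0 ≤ E k
  a_nonneg : 0 ≤ a
  b_nonneg : 0 ≤ b
  Te_lt_Tc : Te < Tc

namespace HeatingTransmitter

/-- The largest allowed deviation `T_δ = T_c - T_e` from the environment temperature. -/
def Tdelta (M : HeatingTransmitter) : ℝ := M.Tc - M.Te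

/-- The energy that has arrived strictly before time `t`, i.e. `∑_{i=0}^{h(t)} E_i` with
`h(t) = max {k | s_k < t}` (the empty sum at `t = 0`). -/
noncomputable def energyBefore (M : HeatingTransmitter) (t : ℝ) : ℝ :=
  ∑ i with M.s i < t, M.E i

/-- The temperature at time `t` under the power policy `P`, with initial temperature `T(0) = T_e`:
the solution of `T' = a P - b (T - T_e)`. -/
noncomputable def temperature (M : HeatingTransmitter) (P : ℝ → ℝ) (t : ℝ) : ℝ :=
  Real.exp (-M.b * t) *
    ((∫ τ in (0 : ℝ)..t, Real.exp (M.b * τ) * (M.a * P τ + M.b * M.Te)) + M.Te)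

/-- `P` is a feasible power policy on `[0, D]`: it is nonnegative, (Lebesgue) measurable with finite
total energy, and satisfies the temperature and the energy causality constraints. Values of `P`
outside `[0, D]` are irrelevant. -/
structure IsFeasible (M : HeatingTransmitter) (P : ℝ → ℝ) : Prop where
  nonneg : ∀ t ∈ Icc 0 M.D, 0 ≤ P t
  integrable : IntegrableOn P (Icc 0 M.D)
  temperature_le : ∀ t ∈ Icc 0 M.D,
    ∫ τ in (0 : ℝ)..t, M.a * Real.exp (M.b * τ) * P τ ≤ M.Tdelta * Real.exp (M.b * t)
  causality : ∀ t ∈ Icc 0 M.D, ∫ τ in (0 : ℝ)..t, P τ ≤ M.energyBefore t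

/-- The throughput `∫_0^D (1/2) log₂ (1 + P)`. It is a genuine integral for feasible `P`, since then
`0 ≤ log (1 + P) ≤ P` and `P` is integrable. -/
noncomputable def throughput (M : HeatingTransmitter) (P : ℝ → ℝ) : ℝ :=
  ∫ τ in (0 : ℝ)..M.D, 1 / 2 * Real.logb 2 (1 + P τ)

/-- `P` maximizes the throughput among all feasible policies. -/
def IsOptimal (M : HeatingTransmitter) (P : ℝ → ℝ) : Prop :=
  M.IsFeasible P ∧ ∀ Q : ℝ → ℝ, M.IsFeasible Q → M.throughput Q ≤ M.throughput P

/-- `t` is an instant (after time zero) at which energy arrives. -/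
def IsArrival (M : HeatingTransmitter) (t : ℝ) : Prop :=
  ∃ k : Fin (M.N + 1), k ≠ 0 ∧ t = M.s k

end HeatingTransmitter

/-- `f` has a positive jump at `t`: it jumps up from its finite left limit to its finite right limit
(and its value at `t` is not outside the range of the jump). -/
def HasPositiveJumpAt (f : ℝ → ℝ) (t : ℝ) : Prop :=
  ∃ l r : ℝ, l < r ∧ Tendsto f (𝓝[<] t) (𝓝 l) ∧ Tendsto f (𝓝[>] t) (𝓝 r) ∧ f t ∈ Icc l r

namespace HeatingTransmitter

variable {M : HeatingTransmitter} {P Q : ℝ → ℝ}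

/-! Feasible policies form a convex set and the throughput is concave, so no feasible perturbation
of an optimal `P` has a positive first-order gain. All perturbations used move energy from a set `A`
to a set `B`.

Moving energy later with weight `e^{-bt}` is harmless for both constraints: the weight cancels the
factor `e^{bt}` of the heat integral, and it only shrinks the energy given back. The marginal gain
of this move is `1 / (e^{bt} (1 + P))`, so `e^{bt} (1 + P)` is essentially nondecreasing
(`scaledPower_null_or_null`). Hence `P` has a version `e^{-bt} G - 1` with `G` monotone, which has
one-sided limits and jumps only upwards.

Moving energy earlier is feasible in small amounts where both constraints are slack, so `P` does not
rise there (`null_or_null_of_slack`). At an upward jump away from arrivals both are slack: a tight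
temperature constraint forces `a P(t⁻) ≥ b T_δ ≥ a P(t⁺)`, and exhausted energy forces `P(t⁺) ≤ 0`.
So jumps occur only at arrivals (`le_of_not_arrival`). The same argument near `D` rules out blow-up
there (`bddAbove_scaledPower`). -/

theorem D_pos (M : HeatingTransmitter) : 0 < M.D := by
  simpa [M.s_zero] using M.s_lt_D 0

theorem Tdelta_pos (M : HeatingTransmitter) : 0 < M.Tdelta := sub_pos.2 M.Te_lt_Tc

theorem energyBefore_mono (M : HeatingTransmitter) : Monotone M.energyBefore := by
  intro x y hxy
  refine Finset.sum_le_sum_of_subset_of_nonneg ?_ fun i _ _ => M.E_nonneg i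
  intro i hi
  simp only [Finset.mem_filter, Finset.mem_univ, true_and] at hi ⊢
  exact hi.trans_le hxy

/-! ### Integrability and modification on null sets -/

theorem intervalIntegrable_of_integrableOn {D x y : ℝ} {f : ℝ → ℝ} (hf : IntegrableOn f (Icc 0 D))
    (hx : x ∈ Icc 0 D) (hy : y ∈ Icc 0 D) : IntervalIntegrable f volume x y :=
  (hf.mono_set (uIcc_subset_Icc hx hy)).intervalIntegrable

theorem integrableOn_exp_mul {D : ℝ} (c : ℝ) {f : ℝ → ℝ} (hf : IntegrableOn f (Icc 0 D)) :
    IntegrableOn (fun t => Real.exp (c * t) * f t) (Icc 0 D) :=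
  hf.continuousOn_mul (by fun_prop) isCompact_Icc

theorem integrableOn_heat (M : HeatingTransmitter) {f : ℝ → ℝ} (hf : IntegrableOn f (Icc 0 M.D)) :
    IntegrableOn (fun t => M.a * Real.exp (M.b * t) * f t) (Icc 0 M.D) := by
  simpa only [mul_assoc, IntegrableOn] using (integrableOn_exp_mul M.b hf).const_mul M.a

theorem continuousOn_integral {D : ℝ} (hD : 0 ≤ D) {f : ℝ → ℝ} (hf : IntegrableOn f (Icc 0 D)) :
    ContinuousOn (fun t => ∫ τ in (0 : ℝ)..t, f τ) (Icc 0 D) := by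
  have := intervalIntegral.continuousOn_primitive_interval (a := 0) (b := D) (f := f)
    (μ := volume) (by rwa [uIcc_of_le hD])
  rwa [uIcc_of_le hD] at this

theorem IsFeasible.continuousOn_temperature (hP : M.IsFeasible P) :
    ContinuousOn (M.temperature P) (Icc 0 M.D) := by
  unfold temperature
  refine ContinuousOn.mul (by fun_prop) (ContinuousOn.add ?_ continuousOn_const)
  refine continuousOn_integral M.D_pos.le (integrableOn_exp_mul M.b ?_)
  exact (hP.integrable.const_mul M.a).add (integrableOn_const (by simp))

theorem integral_congr_of_ae_eq {D t : ℝ} {f g : ℝ → ℝ} (h : f =ᵐ[volume.restrict (Icc 0 D)] g)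
    (F : ℝ → ℝ → ℝ) (ht : t ∈ Icc 0 D) :
    ∫ τ in (0 : ℝ)..t, F τ (f τ) = ∫ τ in (0 : ℝ)..t, F τ (g τ) := by
  rw [intervalIntegral.integral_of_le ht.1, intervalIntegral.integral_of_le ht.1]
  refine integral_congr_ae ?_
  filter_upwards [ae_restrict_of_ae_restrict_of_subset
    (Ioc_subset_Icc_self.trans (Icc_subset_Icc_right ht.2)) h] with x hx
  rw [hx]

theorem IsFeasible.congr_ae (hP : M.IsFeasible P) (h : P =ᵐ[volume.restrict (Icc 0 M.D)] Q)
    (hQ : ∀ t ∈ Icc 0 M.D, 0 ≤ Q t) : M.IsFeasible Q where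
  nonneg := hQ
  integrable := hP.integrable.congr_fun_ae h
  temperature_le t ht := by
    rw [← integral_congr_of_ae_eq h (fun τ y => M.a * Real.exp (M.b * τ) * y) ht]
    exact hP.temperature_le t ht
  causality t ht := by
    rw [← integral_congr_of_ae_eq h (fun τ y => y) ht]
    exact hP.causality t ht

theorem IsOptimal.congr_ae (hP : M.IsOptimal P) (h : P =ᵐ[volume.restrict (Icc 0 M.D)] Q)
    (hQ : ∀ t ∈ Icc 0 M.D, 0 ≤ Q t) : M.IsOptimal Q := by
  refine ⟨hP.1.congr_ae h hQ, fun R hR => (hP.2 R hR).trans_eq ?_⟩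
  exact integral_congr_of_ae_eq h (fun τ y => 1 / 2 * Real.logb 2 (1 + y))
    (right_mem_Icc.2 M.D_pos.le)

/-- Feasibility only gives a.e. measurability, while the perturbations below live on level sets of
the policy, which should be measurable. -/
theorem IsFeasible.exists_measurable (hP : M.IsFeasible P) :
    ∃ Q : ℝ → ℝ, Measurable Q ∧ (∀ t, 0 ≤ Q t) ∧ P =ᵐ[volume.restrict (Icc 0 M.D)] Q := by
  have hm := hP.integrable.aestronglyMeasurable.aemeasurable
  refine ⟨fun t => max 0 (hm.mk P t), measurable_const.max hm.measurable_mk,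
    fun t => le_max_left _ _, ?_⟩
  filter_upwards [hm.ae_eq_mk, ae_restrict_mem measurableSet_Icc] with t ht htm
  rw [← ht, max_eq_right (hP.nonneg t htm)]

/-! ### Convexity and the first-order condition -/

/-- Feasible policies form a convex set. -/
theorem IsFeasible.lineMap (hP : M.IsFeasible P) (hQ : M.IsFeasible Q) {θ : ℝ} (h0 : 0 ≤ θ)
    (h1 : θ ≤ 1) : M.IsFeasible fun t => (1 - θ) * P t + θ * Q t where
  nonneg t ht := add_nonneg (mul_nonneg (sub_nonneg.2 h1) (hP.nonneg t ht))
    (mul_nonneg h0 (hQ.nonneg t ht))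
  integrable := (hP.integrable.const_mul _).add (hQ.integrable.const_mul _)
  temperature_le t ht := by
    have h0m := left_mem_Icc.2 M.D_pos.le
    have e : (fun τ => M.a * Real.exp (M.b * τ) * ((1 - θ) * P τ + θ * Q τ)) =
        fun τ => (1 - θ) * (M.a * Real.exp (M.b * τ) * P τ) +
          θ * (M.a * Real.exp (M.b * τ) * Q τ) := by
      ext τ; ring
    rw [e, intervalIntegral.integral_add
      ((intervalIntegrable_of_integrableOn (M.integrableOn_heat hP.integrable) h0m ht).const_mul _)
      ((intervalIntegrable_of_integrableOn (M.integrableOn_heat hQ.integrable) h0m ht).const_mul _),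
      intervalIntegral.integral_const_mul, intervalIntegral.integral_const_mul]
    have := mul_le_mul_of_nonneg_left (hP.temperature_le t ht) (sub_nonneg.2 h1)
    have := mul_le_mul_of_nonneg_left (hQ.temperature_le t ht) h0
    linarith
  causality t ht := by
    have h0m := left_mem_Icc.2 M.D_pos.le
    rw [intervalIntegral.integral_add
      ((intervalIntegrable_of_integrableOn hP.integrable h0m ht).const_mul _)
      ((intervalIntegrable_of_integrableOn hQ.integrable h0m ht).const_mul _),
      intervalIntegral.integral_const_mul, intervalIntegral.integral_const_mul]
    have := mul_le_mul_of_nonneg_left (hP.causality t ht) (sub_nonneg.2 h1)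
    have := mul_le_mul_of_nonneg_left (hQ.causality t ht) h0
    linarith

theorem IsFeasible.integrableOn_log (hP : M.IsFeasible P) :
    IntegrableOn (fun t => Real.log (1 + P t)) (Icc 0 M.D) := by
  refine Integrable.mono' hP.integrable ?_ ?_
  · exact (Real.measurable_log.comp_aemeasurable
      (hP.integrable.aestronglyMeasurable.aemeasurable.const_add 1)).aestronglyMeasurable
  · filter_upwards [ae_restrict_mem measurableSet_Icc] with t ht
    have := hP.nonneg t ht
    rw [Real.norm_of_nonneg (Real.log_nonneg (by linarith))]
    have := Real.log_le_sub_one_of_pos (x := 1 + P t) (by linarith)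
    linarith

theorem IsFeasible.integrableOn_div (hP : M.IsFeasible P) {h : ℝ → ℝ}
    (hh : IntegrableOn h (Icc 0 M.D)) :
    IntegrableOn (fun t => h t / (1 + P t)) (Icc 0 M.D) := by
  refine Integrable.mono hh ?_ ?_
  · exact (hh.aestronglyMeasurable.aemeasurable.div
      (hP.integrable.aestronglyMeasurable.aemeasurable.const_add 1)).aestronglyMeasurable
  · filter_upwards [ae_restrict_mem measurableSet_Icc] with t ht
    have := hP.nonneg t ht
    rw [norm_div, Real.norm_of_nonneg (by linarith : 0 ≤ 1 + P t)]
    exact div_le_self (norm_nonneg _) (by linarith)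

/-- Concavity of the logarithm, with the slope taken at the endpoint `y`: `1 - 1/u ≤ log u` at `u =
y / x`. -/
theorem div_le_log_sub_log {x y : ℝ} (hx : 0 < x) (hy : 0 < y) :
    (y - x) / y ≤ Real.log y - Real.log x := by
  rw [← Real.log_div hy.ne' hx.ne']
  have := Real.one_sub_inv_le_log_of_pos (div_pos hy hx)
  rwa [inv_div, one_sub_div hy.ne'] at this

/-- The first-order optimality condition for the throughput. -/
theorem IsOptimal.integral_sub_div_le (hP : M.IsOptimal P) (hQ : M.IsFeasible Q) :
    ∫ t in (0 : ℝ)..M.D, (Q t - P t) / (1 + P t) ≤ 0 := by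
  have h0m := left_mem_Icc.2 M.D_pos.le
  have hDm := right_mem_Icc.2 M.D_pos.le
  set R : ℝ → ℝ → ℝ := fun θ t => (1 - θ) * P t + θ * Q t with hR
  have hRf : ∀ θ, 0 ≤ θ → θ ≤ 1 → M.IsFeasible (R θ) := fun θ h0 h1 => hP.1.lineMap hQ h0 h1
  have hd : IntegrableOn (fun t => Q t - P t) (Icc 0 M.D) := hQ.integrable.sub hP.1.integrable
  -- The tangent bound at `R θ` is linear in `θ`; optimality against `R θ` makes its integral
  -- nonpositive, and `θ` cancels.
  have key : ∀ θ, 0 < θ → θ ≤ 1 →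
      ∫ t in (0 : ℝ)..M.D, (Q t - P t) / (1 + R θ t) ≤ 0 := by
    intro θ h0 h1
    have hF := hRf θ h0.le h1
    have h2 := hP.2 _ hF
    unfold throughput at h2
    simp only [Real.logb, ← mul_div_assoc, intervalIntegral.integral_div,
      intervalIntegral.integral_const_mul] at h2
    have hl2 : 0 < Real.log 2 := Real.log_pos (by norm_num)
    rw [div_le_div_iff_of_pos_right hl2, mul_le_mul_iff_right₀ (by norm_num)] at h2
    have h3 : ∫ t in (0 : ℝ)..M.D, θ * ((Q t - P t) / (1 + R θ t)) ≤
        ∫ t in (0 : ℝ)..M.D, (Real.log (1 + R θ t) - Real.log (1 + P t)) := by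
      refine intervalIntegral.integral_mono_on M.D_pos.le
        ((intervalIntegrable_of_integrableOn (hF.integrableOn_div hd) h0m hDm).const_mul _)
        ((intervalIntegrable_of_integrableOn hF.integrableOn_log h0m hDm).sub
          (intervalIntegrable_of_integrableOn hP.1.integrableOn_log h0m hDm)) fun t ht => ?_
      have e1 := hF.nonneg t ht
      have e2 := hP.1.nonneg t ht
      refine le_trans (le_of_eq ?_)
        (div_le_log_sub_log (by linarith : 0 < 1 + P t) (by linarith : 0 < 1 + R θ t))
      rw [← mul_div_assoc]
      congr 1
      simp only [hR]; ring
    rw [intervalIntegral.integral_sub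
      (intervalIntegrable_of_integrableOn hF.integrableOn_log h0m hDm)
      (intervalIntegrable_of_integrableOn hP.1.integrableOn_log h0m hDm),
      intervalIntegral.integral_const_mul] at h3
    by_contra! h4
    have := mul_pos h0 h4
    linarith
  -- Dominated convergence as `θ → 0`; since `1 + R θ ≥ 1`, the bound is `|Q - P|`.
  have hlim : Tendsto (fun n : ℕ => ∫ t in (0 : ℝ)..M.D, (Q t - P t) / (1 + R (1 / ((n : ℝ) + 1)) t))
      atTop (𝓝 (∫ t in (0 : ℝ)..M.D, (Q t - P t) / (1 + P t))) := by
    have hn : ∀ n : ℕ, 0 < 1 / ((n : ℝ) + 1) ∧ 1 / ((n : ℝ) + 1) ≤ 1 := fun n =>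
      ⟨Nat.one_div_pos_of_nat, by
        rw [div_le_one (by positivity)]; linarith [n.cast_nonneg (α := ℝ)]⟩
    simp only [intervalIntegral.integral_of_le M.D_pos.le]
    have hsub : Ioc 0 M.D ⊆ Icc 0 M.D := Ioc_subset_Icc_self
    refine tendsto_integral_of_dominated_convergence (fun t => ‖Q t - P t‖) ?_
      (hd.mono_set hsub).norm ?_ ?_
    · intro n
      exact (((hRf _ (hn n).1.le (hn n).2).integrableOn_div hd).mono_set hsub).aestronglyMeasurable
    · intro n
      filter_upwards [ae_restrict_mem measurableSet_Ioc] with t ht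
      have := (hRf _ (hn n).1.le (hn n).2).nonneg t (hsub ht)
      rw [norm_div, Real.norm_of_nonneg (by linarith : 0 ≤ 1 + R (1 / ((n : ℝ) + 1)) t)]
      exact div_le_self (norm_nonneg _) (by linarith)
    · filter_upwards [ae_restrict_mem measurableSet_Ioc] with t ht
      have h1 := hP.1.nonneg t (hsub ht)
      have hc : ContinuousAt (fun θ : ℝ => (Q t - P t) / (1 + R θ t)) 0 := by
        refine ContinuousAt.div continuousAt_const (by simp only [hR]; fun_prop) ?_
        simp only [hR]
        simp
        linarith
      have := hc.tendsto.comp (tendsto_one_div_add_atTop_nhds_zero_nat (𝕜 := ℝ))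
      simpa [hR, Function.comp_def] using this
  exact le_of_tendsto' hlim fun n => key _ Nat.one_div_pos_of_nat (by
    rw [div_le_one (by positivity)]; linarith [n.cast_nonneg (α := ℝ)])

/-! ### Power on either side of an instant where a constraint is tight -/

theorem mul_integral_exp (b x y : ℝ) :
    b * ∫ τ in x..y, Real.exp (b * τ) = Real.exp (b * y) - Real.exp (b * x) := by
  rw [← intervalIntegral.integral_const_mul]
  refine intervalIntegral.integral_eq_sub_of_hasDerivAt (f := fun τ => Real.exp (b * τ))
    (fun τ _ => ?_) ((by fun_prop : Continuous fun τ => b * Real.exp (b * τ)).intervalIntegrable _ _)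
  simpa [mul_comm] using ((hasDerivAt_id τ).const_mul b).exp

theorem integral_exp_pos (b : ℝ) {x y : ℝ} (h : x < y) : 0 < ∫ τ in x..y, Real.exp (b * τ) :=
  intervalIntegral.intervalIntegral_pos_of_pos
    ((by fun_prop : Continuous fun τ => Real.exp (b * τ)).intervalIntegrable _ _)
    (fun _ => Real.exp_pos _) h

/-- The weighted energy in excess of what the temperature constraint allows. -/
noncomputable def heatExcess (M : HeatingTransmitter) (P : ℝ → ℝ) (t : ℝ) : ℝ :=
  (∫ τ in (0 : ℝ)..t, M.a * Real.exp (M.b * τ) * P τ) - M.Tdelta * Real.exp (M.b * t)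

theorem IsFeasible.heatExcess_nonpos (hP : M.IsFeasible P) {t : ℝ} (ht : t ∈ Icc 0 M.D) :
    M.heatExcess P t ≤ 0 := sub_nonpos.2 (hP.temperature_le t ht)

theorem IsFeasible.heatExcess_sub (hP : M.IsFeasible P) {x y : ℝ} (hx : x ∈ Icc 0 M.D)
    (hy : y ∈ Icc 0 M.D) :
    M.heatExcess P y - M.heatExcess P x = (∫ τ in x..y, M.a * Real.exp (M.b * τ) * P τ) -
      M.b * M.Tdelta * ∫ τ in x..y, Real.exp (M.b * τ) := by
  have h0m := left_mem_Icc.2 M.D_pos.le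
  have hi := M.integrableOn_heat hP.integrable
  have := intervalIntegral.integral_interval_sub_left (intervalIntegrable_of_integrableOn hi h0m hy)
    (intervalIntegrable_of_integrableOn hi h0m hx)
  rw [← this, mul_right_comm, mul_integral_exp]
  simp only [heatExcess]
  ring

/-- `heatExcess` has density `e^{bτ} (a P - b T_δ)`. It is nonpositive at `α` and zero at `t`, so
this density has nonnegative integral over `(α, t)`. The next lemma is the mirror image. -/
theorem IsFeasible.le_of_heatExcess_eq_zero_left (hP : M.IsFeasible P) {α t c : ℝ} (hα : 0 ≤ α)
    (hαt : α < t) (ht : t ≤ M.D) (h0 : M.heatExcess P t = 0) (hc : ∀ᵐ τ, τ ∈ Ioo α t → P τ ≤ c) :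
    M.b * M.Tdelta ≤ M.a * c := by
  have hαm : α ∈ Icc 0 M.D := ⟨hα, hαt.le.trans ht⟩
  have htm : t ∈ Icc 0 M.D := ⟨hα.trans hαt.le, ht⟩
  have h1 := hP.heatExcess_sub hαm htm
  have h2 := hP.heatExcess_nonpos hαm
  have h3 : ∫ τ in α..t, M.a * Real.exp (M.b * τ) * P τ ≤
      ∫ τ in α..t, M.a * c * Real.exp (M.b * τ) := by
    refine intervalIntegral.integral_mono_ae_restrict hαt.le
      (intervalIntegrable_of_integrableOn (M.integrableOn_heat hP.integrable) hαm htm)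
      ((by fun_prop : Continuous fun τ => M.a * c * Real.exp (M.b * τ)).intervalIntegrable _ _) ?_
    rw [← restrict_Ioo_eq_restrict_Icc]
    filter_upwards [ae_restrict_mem measurableSet_Ioo, ae_restrict_of_ae hc] with τ h h'
    have := mul_le_mul_of_nonneg_left (h' h)
      (mul_nonneg M.a_nonneg (Real.exp_pos (M.b * τ)).le)
    linarith
  rw [intervalIntegral.integral_const_mul] at h3
  have := integral_exp_pos M.b hαt
  refine le_of_mul_le_mul_right ?_ this
  linarith

theorem IsFeasible.le_of_heatExcess_eq_zero_right (hP : M.IsFeasible P) {δ t c : ℝ} (h0t : 0 ≤ t)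
    (htδ : t < δ) (hδ : δ ≤ M.D) (h0 : M.heatExcess P t = 0) (hc : ∀ᵐ τ, τ ∈ Ioo t δ → c ≤ P τ) :
    M.a * c ≤ M.b * M.Tdelta := by
  have htm : t ∈ Icc 0 M.D := ⟨h0t, htδ.le.trans hδ⟩
  have hδm : δ ∈ Icc 0 M.D := ⟨h0t.trans htδ.le, hδ⟩
  have h1 := hP.heatExcess_sub htm hδm
  have h2 := hP.heatExcess_nonpos hδm
  have h3 : ∫ τ in t..δ, M.a * c * Real.exp (M.b * τ) ≤
      ∫ τ in t..δ, M.a * Real.exp (M.b * τ) * P τ := by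
    refine intervalIntegral.integral_mono_ae_restrict htδ.le
      ((by fun_prop : Continuous fun τ => M.a * c * Real.exp (M.b * τ)).intervalIntegrable _ _)
      (intervalIntegrable_of_integrableOn (M.integrableOn_heat hP.integrable) htm hδm) ?_
    rw [← restrict_Ioo_eq_restrict_Icc]
    filter_upwards [ae_restrict_mem measurableSet_Ioo, ae_restrict_of_ae hc] with τ h h'
    have := mul_le_mul_of_nonneg_left (h' h)
      (mul_nonneg M.a_nonneg (Real.exp_pos (M.b * τ)).le)
    linarith
  rw [intervalIntegral.integral_const_mul] at h3
  have := integral_exp_pos M.b htδ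
  refine le_of_mul_le_mul_right ?_ this
  linarith

/-- All energy is spent by `t` and none arrives in time for use before `δ`, so nothing can be spent
on `(t, δ)`. -/
theorem IsFeasible.nonpos_of_energy_eq (hP : M.IsFeasible P) {δ t c : ℝ} (h0t : 0 ≤ t)
    (htδ : t < δ) (hδ : δ ≤ M.D) (h0 : ∫ τ in (0 : ℝ)..t, P τ = M.energyBefore t)
    (hA : M.energyBefore δ ≤ M.energyBefore t) (hc : ∀ᵐ τ, τ ∈ Ioo t δ → c ≤ P τ) :
    c ≤ 0 := by
  have htm : t ∈ Icc 0 M.D := ⟨h0t, htδ.le.trans hδ⟩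
  have hδm : δ ∈ Icc 0 M.D := ⟨h0t.trans htδ.le, hδ⟩
  have h0m := left_mem_Icc.2 M.D_pos.le
  have h1 := intervalIntegral.integral_interval_sub_left
    (intervalIntegrable_of_integrableOn hP.integrable h0m hδm)
    (intervalIntegrable_of_integrableOn hP.integrable h0m htm)
  have h2 := hP.causality δ hδm
  have h3 : ∫ _ in t..δ, c ≤ ∫ τ in t..δ, P τ := by
    refine intervalIntegral.integral_mono_ae_restrict htδ.le (by simp)
      (intervalIntegrable_of_integrableOn hP.integrable htm hδm) ?_
    rw [← restrict_Ioo_eq_restrict_Icc]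
    filter_upwards [ae_restrict_mem measurableSet_Ioo, ae_restrict_of_ae hc] with τ h h'
    exact h' h
  rw [intervalIntegral.integral_const, smul_eq_mul] at h3
  by_contra! hpos
  have := mul_pos (sub_pos.2 htδ) hpos
  linarith

/-! ### Transfers of energy between two sets -/

/-- The perturbation that takes energy from the set `A` and gives it to the set `B`. -/
noncomputable def transfer (A B : Set ℝ) (t : ℝ) : ℝ :=
  volume.real A * B.indicator 1 t - volume.real B * A.indicator 1 t

section transfer

variable {A B : Set ℝ} {D q : ℝ}

theorem measurable_transfer (hA : MeasurableSet A) (hB : MeasurableSet B) :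
    Measurable (transfer A B) :=
  ((measurable_one.indicator hB).const_mul _).sub ((measurable_one.indicator hA).const_mul _)

theorem abs_transfer_le (A B : Set ℝ) (t : ℝ) :
    |transfer A B t| ≤ volume.real A + volume.real B := by
  have hA : 0 ≤ volume.real A := measureReal_nonneg
  have hB : 0 ≤ volume.real B := measureReal_nonneg
  unfold transfer
  by_cases h1 : t ∈ A <;> by_cases h2 : t ∈ B <;> simp [h1, h2, abs_le] <;> (try constructor) <;>
    linarith

theorem integrableOn_transfer (hA : MeasurableSet A) (hB : MeasurableSet B) :
    IntegrableOn (transfer A B) (Icc 0 D) :=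
  Measure.integrableOn_of_bounded (M := volume.real A + volume.real B) (by simp)
    (measurable_transfer hA hB).aestronglyMeasurable (ae_of_all _ (abs_transfer_le A B))

theorem transfer_nonneg {t : ℝ} (ht : t ∉ A) : 0 ≤ transfer A B t := by
  simp only [transfer, indicator_of_notMem ht, mul_zero, sub_zero]
  exact mul_nonneg measureReal_nonneg (indicator_nonneg (fun _ _ => zero_le_one) _)

theorem transfer_nonpos {t : ℝ} (ht : t ∉ B) : transfer A B t ≤ 0 := by
  simp only [transfer, indicator_of_notMem ht, mul_zero, zero_sub, neg_nonpos]
  exact mul_nonneg measureReal_nonneg (indicator_nonneg (fun _ _ => zero_le_one) _)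

theorem transfer_eq_zero {t : ℝ} (hA : t ∉ A) (hB : t ∉ B) : transfer A B t = 0 :=
  le_antisymm (transfer_nonpos hB) (transfer_nonneg hA)

theorem integral_indicator_one_eq (hD : 0 ≤ D) (hA : MeasurableSet A) (hAD : A ⊆ Ioc 0 D) :
    ∫ t in (0 : ℝ)..D, A.indicator 1 t = volume.real A := by
  rw [intervalIntegral.integral_of_le hD, setIntegral_indicator hA, inter_eq_right.2 hAD]
  simp

theorem intervalIntegrable_indicator_one (hA : MeasurableSet A) :
    IntervalIntegrable (A.indicator (1 : ℝ → ℝ)) volume 0 D := by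
  rw [intervalIntegrable_iff]
  exact (integrableOn_const (C := (1 : ℝ)) (by simp)).indicator hA

theorem integral_transfer_eq_zero (hD : 0 ≤ D) (hA : MeasurableSet A) (hB : MeasurableSet B)
    (hAD : A ⊆ Ioc 0 D) (hBD : B ⊆ Ioc 0 D) : ∫ t in (0 : ℝ)..D, transfer A B t = 0 := by
  unfold transfer
  rw [intervalIntegral.integral_sub ((intervalIntegrable_indicator_one hB).const_mul _)
    ((intervalIntegrable_indicator_one hA).const_mul _), intervalIntegral.integral_const_mul,
    intervalIntegral.integral_const_mul, integral_indicator_one_eq hD hA hAD,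
    integral_indicator_one_eq hD hB hBD]
  ring

/-- Donors precede `q` and recipients follow it: the running integral decreases up to `q`, then
increases to its final value zero. -/
theorem integral_transfer_nonpos (hA : MeasurableSet A) (hB : MeasurableSet B)
    (hAq : A ⊆ Ioc 0 q) (hBq : B ⊆ Ioc q D) (hq : q ∈ Icc 0 D) {t : ℝ} (ht : t ∈ Icc 0 D) :
    ∫ τ in (0 : ℝ)..t, transfer A B τ ≤ 0 := by
  have hD : 0 ≤ D := hq.1.trans hq.2
  rcases le_total t q with h | h
  · rw [intervalIntegral.integral_of_le ht.1]
    refine setIntegral_nonpos measurableSet_Ioc fun τ hτ => transfer_nonpos fun hτB => ?_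
    exact absurd (hBq hτB).1 (not_lt.2 (hτ.2.trans h))
  · have h1 := integral_transfer_eq_zero hD hA hB (hAq.trans (Ioc_subset_Ioc_right hq.2))
      (hBq.trans (Ioc_subset_Ioc_left hq.1))
    rw [← intervalIntegral.integral_add_adjacent_intervals (b := t)
      (intervalIntegrable_of_integrableOn (integrableOn_transfer hA hB) (left_mem_Icc.2 hD) ht)
      (intervalIntegrable_of_integrableOn (integrableOn_transfer hA hB) ht (right_mem_Icc.2 hD))]
      at h1
    have h2 : 0 ≤ ∫ τ in t..D, transfer A B τ := by
      rw [intervalIntegral.integral_of_le ht.2]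
      refine setIntegral_nonneg measurableSet_Ioc fun τ hτ => transfer_nonneg fun hτA => ?_
      exact absurd (hAq hτA).2 (not_le.2 (h.trans_lt hτ.1))
    linarith

end transfer

/-- An optimal policy admits no feasible transfer of energy, weighted by `φ`, that improves the
throughput to first order. -/
theorem IsOptimal.not_isFeasible_add_transfer (hP : M.IsOptimal P) {A B : Set ℝ}
    (hA : MeasurableSet A) (hB : MeasurableSet B) (hAD : A ⊆ Ioc 0 M.D) (hBD : B ⊆ Ioc 0 M.D)
    (hA0 : 0 < volume.real A) (hB0 : 0 < volume.real B) {φ : ℝ → ℝ} {k₁ k₂ ε : ℝ} (hk : k₁ < k₂)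
    (h1 : ∀ t ∈ A, φ t / (1 + P t) ≤ k₁) (h2 : ∀ t ∈ B, k₂ ≤ φ t / (1 + P t)) (hε : 0 < ε) :
    ¬ M.IsFeasible fun t => P t + ε * (φ t * transfer A B t) := by
  intro hQ
  have h0m := left_mem_Icc.2 M.D_pos.le
  have hDm := right_mem_Icc.2 M.D_pos.le
  have h3 := hP.integral_sub_div_le hQ
  have hiA := (intervalIntegrable_indicator_one (D := M.D) hA).const_mul (volume.real B * k₁)
  have hiB := (intervalIntegrable_indicator_one (D := M.D) hB).const_mul (volume.real A * k₂)
  -- `φ / (1 + P)` is the marginal gain: at most `k₁` where energy is taken, at least `k₂` where it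
  -- is given. The first-order gain is thus at least `ε |A| |B| (k₂ - k₁) > 0`.
  have h4 : ∫ t in (0 : ℝ)..M.D, ε * (volume.real A * k₂ * B.indicator 1 t -
      volume.real B * k₁ * A.indicator 1 t) ≤
      ∫ t in (0 : ℝ)..M.D, (P t + ε * (φ t * transfer A B t) - P t) / (1 + P t) := by
    refine intervalIntegral.integral_mono_on M.D_pos.le ((hiB.sub hiA).const_mul ε)
      (intervalIntegrable_of_integrableOn
        (hP.1.integrableOn_div (hQ.integrable.sub hP.1.integrable)) h0m hDm) fun t _ => ?_
    have e : (P t + ε * (φ t * transfer A B t) - P t) / (1 + P t) =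
        ε * (volume.real A * (φ t / (1 + P t)) * B.indicator 1 t -
          volume.real B * (φ t / (1 + P t)) * A.indicator 1 t) := by
      simp only [transfer]; ring
    rw [e]
    refine mul_le_mul_of_nonneg_left (sub_le_sub ?_ ?_) hε.le
    · by_cases h : t ∈ B
      · simpa [h] using mul_le_mul_of_nonneg_left (h2 t h) hA0.le
      · simp [h]
    · by_cases h : t ∈ A
      · simpa [h] using mul_le_mul_of_nonneg_left (h1 t h) hB0.le
      · simp [h]
  rw [intervalIntegral.integral_const_mul, intervalIntegral.integral_sub hiB hiA,
    intervalIntegral.integral_const_mul, intervalIntegral.integral_const_mul,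
    integral_indicator_one_eq M.D_pos.le hA hAD, integral_indicator_one_eq M.D_pos.le hB hBD] at h4
  have : 0 < ε * (volume.real A * k₂ * volume.real B - volume.real B * k₁ * volume.real A) := by
    have := mul_pos (mul_pos hA0 hB0) (sub_pos.2 hk)
    refine mul_pos hε ?_
    linarith
  linarith

theorem volume_real_pos {D : ℝ} {A : Set ℝ} (hA : A ⊆ Ioc 0 D) (h : volume A ≠ 0) :
    0 < volume.real A :=
  ENNReal.toReal_pos h (measure_ne_top_of_subset hA (by simp))

theorem IsFeasible.add_mul (hP : M.IsFeasible P) {h : ℝ → ℝ} (hh : IntegrableOn h (Icc 0 M.D))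
    {ε : ℝ} (h0 : ∀ t ∈ Icc 0 M.D, 0 ≤ P t + ε * h t)
    (h1 : ∀ t ∈ Icc 0 M.D,
      M.heatExcess P t + ε * ∫ τ in (0 : ℝ)..t, M.a * Real.exp (M.b * τ) * h τ ≤ 0)
    (h2 : ∀ t ∈ Icc 0 M.D,
      (∫ τ in (0 : ℝ)..t, P τ) + ε * ∫ τ in (0 : ℝ)..t, h τ ≤ M.energyBefore t) :
    M.IsFeasible fun t => P t + ε * h t where
  nonneg := h0
  integrable := hP.integrable.add (hh.const_mul ε)
  temperature_le t ht := by
    have h0m := left_mem_Icc.2 M.D_pos.le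
    have e : (fun τ => M.a * Real.exp (M.b * τ) * (P τ + ε * h τ)) =
        fun τ => M.a * Real.exp (M.b * τ) * P τ + ε * (M.a * Real.exp (M.b * τ) * h τ) := by
      ext τ; ring
    rw [e, intervalIntegral.integral_add
      (intervalIntegrable_of_integrableOn (M.integrableOn_heat hP.integrable) h0m ht)
      ((intervalIntegrable_of_integrableOn (M.integrableOn_heat hh) h0m ht).const_mul _),
      intervalIntegral.integral_const_mul]
    have := h1 t ht
    simp only [heatExcess] at this
    linarith
  causality t ht := by
    have h0m := left_mem_Icc.2 M.D_pos.le
    rw [intervalIntegral.integral_add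
      (intervalIntegrable_of_integrableOn hP.integrable h0m ht)
      ((intervalIntegrable_of_integrableOn hh h0m ht).const_mul _),
      intervalIntegral.integral_const_mul]
    exact h2 t ht

/-! ### Moving energy later -/

/-- The quantity `e^{bt} (1 + P(t))`, which an optimal policy never lets decrease. -/
noncomputable def scaledPower (M : HeatingTransmitter) (P : ℝ → ℝ) (t : ℝ) : ℝ :=
  Real.exp (M.b * t) * (1 + P t)

theorem measurable_scaledPower (M : HeatingTransmitter) (hm : Measurable P) :
    Measurable (M.scaledPower P) :=
  (by fun_prop : Measurable fun t => Real.exp (M.b * t)).mul (hm.const_add 1)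

/-- If neither set were null, the transfer from the first to the second with weight `e^{-bt}` would
be feasible and profitable, its marginal gain being the inverse of `scaledPower`. -/
theorem IsOptimal.scaledPower_null_or_null (hP : M.IsOptimal P) (hm : Measurable P) {q c c' : ℝ}
    (hq : q ∈ Icc 0 M.D) (hc : c < c') :
    volume {t | t ∈ Ioo 0 q ∧ c' ≤ M.scaledPower P t} = 0 ∨
      volume {t | t ∈ Ioo q M.D ∧ M.scaledPower P t ≤ c} = 0 := by
  by_contra! hcon
  set A := {t | t ∈ Ioo 0 q ∧ c' ≤ M.scaledPower P t} with hAdef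
  set B := {t | t ∈ Ioo q M.D ∧ M.scaledPower P t ≤ c} with hBdef
  have hΦ := M.measurable_scaledPower hm
  have hA : MeasurableSet A := measurableSet_Ioo.inter (measurableSet_le measurable_const hΦ)
  have hB : MeasurableSet B := measurableSet_Ioo.inter (measurableSet_le hΦ measurable_const)
  have hAq : A ⊆ Ioc 0 q := fun t ht => Ioo_subset_Ioc_self ht.1
  have hBq : B ⊆ Ioc q M.D := fun t ht => Ioo_subset_Ioc_self ht.1
  have hAD : A ⊆ Ioc 0 M.D := hAq.trans (Ioc_subset_Ioc_right hq.2)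
  have hBD : B ⊆ Ioc 0 M.D := hBq.trans (Ioc_subset_Ioc_left hq.1)
  have hA0 := volume_real_pos hAD hcon.1
  have hB0 := volume_real_pos hBD hcon.2
  have hone : ∀ t ∈ Icc 0 M.D, Real.exp (M.b * t) ≤ M.scaledPower P t := fun t ht => by
    have := mul_nonneg (Real.exp_pos (M.b * t)).le (hP.1.nonneg t ht)
    unfold scaledPower
    linarith
  obtain ⟨x, hx⟩ : B.Nonempty := nonempty_of_measure_ne_zero hcon.2
  have hqc : Real.exp (M.b * q) ≤ c :=
    (Real.exp_le_exp.2 (mul_le_mul_of_nonneg_left (hBq hx).1.le M.b_nonneg)).trans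
      ((hone x (Ioc_subset_Icc_self (hBD hx))).trans hx.2)
  have hc0 : 0 < c := (Real.exp_pos _).trans_le hqc
  -- A positive lower bound for `P` on `A`, because `c' > c ≥ e^{bq}`. The perturbation is at most
  -- `C` in absolute value, so step size `κ / C` keeps the policy nonnegative.
  set κ := c' / Real.exp (M.b * q) - 1 with hκ
  have hκ0 : 0 < κ := sub_pos.2 ((one_lt_div (Real.exp_pos _)).2 (hqc.trans_lt hc))
  have hPA : ∀ t ∈ A, κ ≤ P t := fun t ht => by
    have h1 : c' / Real.exp (M.b * q) ≤ c' / Real.exp (M.b * t) :=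
      div_le_div_of_nonneg_left (hc0.trans hc).le (Real.exp_pos _)
        (Real.exp_le_exp.2 (mul_le_mul_of_nonneg_left ht.1.2.le M.b_nonneg))
    have h2 : c' / Real.exp (M.b * t) ≤ 1 + P t := by
      rw [div_le_iff₀' (Real.exp_pos _)]
      exact ht.2
    linarith
  set C := volume.real A + volume.real B with hC
  have hC0 : 0 < C := add_pos hA0 hB0
  have hinv : ∀ t, Real.exp (-M.b * t) / (1 + P t) = (M.scaledPower P t)⁻¹ := fun t => by
    rw [scaledPower, mul_inv, ← Real.exp_neg, neg_mul, div_eq_mul_inv]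
  have hk : c'⁻¹ < c⁻¹ := inv_strictAnti₀ hc0 hc
  have hin : IntegrableOn (transfer A B) (Icc 0 M.D) := integrableOn_transfer hA hB
  have hih := integrableOn_exp_mul (-M.b) hin
  have h0m := left_mem_Icc.2 M.D_pos.le
  refine hP.not_isFeasible_add_transfer hA hB hAD hBD hA0 hB0 (φ := fun t => Real.exp (-M.b * t))
    (ε := κ / C) hk (fun t ht => ?_) (fun t ht => ?_) (div_pos hκ0 hC0)
    (hP.1.add_mul hih (fun t ht => ?_) (fun t ht => ?_) (fun t ht => ?_))
  · rw [hinv]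
    exact inv_anti₀ (hc0.trans hc) ht.2
  · rw [hinv]
    exact inv_anti₀ ((Real.exp_pos _).trans_le (hone t (Ioc_subset_Icc_self (hBD ht)))) ht.2
  · have hε : 0 ≤ κ / C := (div_pos hκ0 hC0).le
    by_cases htA : t ∈ A
    · have h1 : Real.exp (-M.b * t) ≤ 1 :=
        Real.exp_le_one_iff.2 (by have := mul_nonneg M.b_nonneg ht.1; linarith)
      have h2 : |Real.exp (-M.b * t) * transfer A B t| ≤ C := by
        rw [abs_mul, abs_of_pos (Real.exp_pos _)]
        exact (mul_le_of_le_one_left (abs_nonneg _) h1).trans (abs_transfer_le A B t)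
      have h3 := mul_le_mul_of_nonneg_left (neg_le_of_abs_le h2) hε
      rw [mul_neg, div_mul_cancel₀ _ hC0.ne'] at h3
      linarith [hPA t htA]
    · exact add_nonneg (hP.1.nonneg t ht)
        (mul_nonneg hε (mul_nonneg (Real.exp_pos _).le (transfer_nonneg htA)))
  · have e : (fun τ => M.a * Real.exp (M.b * τ) * (Real.exp (-M.b * τ) * transfer A B τ)) =
        fun τ => M.a * transfer A B τ := by
      ext τ
      rw [mul_assoc, ← mul_assoc (Real.exp _), ← Real.exp_add]
      simp
    rw [e, intervalIntegral.integral_const_mul]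
    have h1 := mul_nonpos_of_nonneg_of_nonpos (div_pos hκ0 hC0).le
      (mul_nonpos_of_nonneg_of_nonpos M.a_nonneg (integral_transfer_nonpos hA hB hAq hBq hq ht))
    linarith [hP.1.heatExcess_nonpos ht]
  -- Freezing the decreasing weight at `q` only raises the integrand: the transfer is nonpositive
  -- before `q` and nonnegative after it.
  · have h1 : ∫ τ in (0 : ℝ)..t, Real.exp (-M.b * τ) * transfer A B τ ≤
        ∫ τ in (0 : ℝ)..t, Real.exp (-M.b * q) * transfer A B τ := by
      refine intervalIntegral.integral_mono_on ht.1 (intervalIntegrable_of_integrableOn hih h0m ht)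
        ((intervalIntegrable_of_integrableOn hin h0m ht).const_mul _) fun τ _ => ?_
      rcases le_total τ q with h | h
      · refine mul_le_mul_of_nonpos_right (Real.exp_le_exp.2 ?_)
          (transfer_nonpos fun hτ => absurd hτ.1.1 h.not_gt)
        have := mul_le_mul_of_nonneg_left h M.b_nonneg
        linarith
      · refine mul_le_mul_of_nonneg_right (Real.exp_le_exp.2 ?_)
          (transfer_nonneg fun hτ => absurd hτ.1.2 h.not_gt)
        have := mul_le_mul_of_nonneg_left h M.b_nonneg
        linarith
    rw [intervalIntegral.integral_const_mul] at h1
    have h2 := mul_nonpos_of_nonneg_of_nonpos (div_pos hκ0 hC0).le (h1.trans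
      (mul_nonpos_of_nonneg_of_nonpos (Real.exp_pos _).le
        (integral_transfer_nonpos hA hB hAq hBq hq ht)))
    linarith [hP.1.causality t ht]

/-! ### Moving energy earlier where both constraints are slack -/

/-- `energyBefore` is constant on `[α, δ]`, so both margins are continuous there and compactness
makes them uniform. -/
theorem IsFeasible.exists_slack (hP : M.IsFeasible P) {α δ : ℝ} (hα : 0 ≤ α) (hδ : δ ≤ M.D)
    (hA : M.energyBefore δ ≤ M.energyBefore α)
    (hs : ∀ t ∈ Icc α δ, M.heatExcess P t < 0 ∧ ∫ τ in (0 : ℝ)..t, P τ < M.energyBefore t) :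
    ∃ η > 0, ∀ t ∈ Icc α δ, M.heatExcess P t + η ≤ 0 ∧
      (∫ τ in (0 : ℝ)..t, P τ) + η ≤ M.energyBefore t := by
  have hsub : Icc α δ ⊆ Icc 0 M.D := Icc_subset_Icc hα hδ
  have hAt : ∀ t ∈ Icc α δ, M.energyBefore t = M.energyBefore α := fun t ht =>
    le_antisymm ((M.energyBefore_mono ht.2).trans hA) (M.energyBefore_mono ht.1)
  have hc : ContinuousOn (fun t => min (-M.heatExcess P t)
      (M.energyBefore α - ∫ τ in (0 : ℝ)..t, P τ)) (Icc α δ) := by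
    refine ContinuousOn.inf (ContinuousOn.neg (ContinuousOn.sub ?_ (by fun_prop)))
      (ContinuousOn.sub continuousOn_const ?_)
    · exact (continuousOn_integral M.D_pos.le (M.integrableOn_heat hP.integrable)).mono hsub
    · exact (continuousOn_integral M.D_pos.le hP.integrable).mono hsub
  obtain ⟨η, hη, h⟩ := isCompact_Icc.exists_forall_le' hc (a := 0) fun t ht =>
    lt_min (by linarith [(hs t ht).1]) (by linarith [(hs t ht).2, hAt t ht])
  refine ⟨η, hη, fun t ht => ?_⟩
  have := le_min_iff.1 (h t ht)
  rw [hAt t ht]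
  constructor <;> linarith

/-- Where no constraint is tight, an optimal policy does not go up. -/
theorem IsOptimal.null_or_null_of_slack (hP : M.IsOptimal P) (hm : Measurable P)
    {α q δ c₁ c₂ : ℝ} (hα : 0 ≤ α) (hαq : α ≤ q) (hqδ : q ≤ δ) (hδ : δ ≤ M.D)
    (hE : M.energyBefore δ ≤ M.energyBefore α)
    (hs : ∀ t ∈ Icc α δ, M.heatExcess P t < 0 ∧ ∫ τ in (0 : ℝ)..t, P τ < M.energyBefore t)
    (hc : c₁ < c₂) :
    volume {t | t ∈ Ioo α q ∧ P t ≤ c₁} = 0 ∨ volume {t | t ∈ Ioo q δ ∧ c₂ ≤ P t} = 0 := by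
  by_contra! hcon
  set B := {t | t ∈ Ioo α q ∧ P t ≤ c₁} with hBdef
  set A := {t | t ∈ Ioo q δ ∧ c₂ ≤ P t} with hAdef
  have hB : MeasurableSet B := measurableSet_Ioo.inter (measurableSet_le hm measurable_const)
  have hA : MeasurableSet A := measurableSet_Ioo.inter (measurableSet_le measurable_const hm)
  have hBD : B ⊆ Ioc 0 M.D := fun t ht => ⟨hα.trans_lt ht.1.1, (ht.1.2.le.trans hqδ).trans hδ⟩
  have hAD : A ⊆ Ioc 0 M.D :=
    fun t ht => ⟨(hα.trans hαq).trans_lt ht.1.1, ht.1.2.le.trans hδ⟩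
  have hA0 := volume_real_pos hAD hcon.2
  have hB0 := volume_real_pos hBD hcon.1
  obtain ⟨x, hx⟩ : B.Nonempty := nonempty_of_measure_ne_zero hcon.1
  have hc0 : 0 ≤ c₁ := (hP.1.nonneg x (Ioc_subset_Icc_self (hBD hx))).trans hx.2
  obtain ⟨η, hη, hslack⟩ := hP.1.exists_slack hα hδ hE hs
  set C := volume.real A + volume.real B with hC
  have hC0 : 0 < C := add_pos hA0 hB0
  have hin : IntegrableOn (transfer A B) (Icc 0 M.D) := integrableOn_transfer hA hB
  have h0m := left_mem_Icc.2 M.D_pos.le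
  have hDm := right_mem_Icc.2 M.D_pos.le
  set K : ℝ → ℝ := fun t => ∫ τ in (0 : ℝ)..t, transfer A B τ with hK
  have hKle : ∀ t ∈ Icc 0 M.D, K t ≤ C * M.D := fun t ht => by
    have h1 := intervalIntegral.norm_integral_le_of_norm_le_const (a := 0) (b := t)
      (f := transfer A B) (C := C) fun τ _ => abs_transfer_le A B τ
    rw [sub_zero, abs_of_nonneg ht.1] at h1
    exact (le_abs_self _).trans (h1.trans (mul_le_mul_of_nonneg_left ht.2 hC0.le))
  -- The running transfer vanishes outside `[α, δ]`, so only the slack region has to absorb it.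
  have hK0 : ∀ t ∈ Icc 0 M.D, t ∉ Icc α δ → K t = 0 := fun t ht hn => by
    rcases not_and_or.1 hn with h | h
    · refine intervalIntegral.integral_zero_ae (ae_of_all _ fun τ hτ => ?_)
      rw [uIoc_of_le ht.1] at hτ
      have : τ < α := hτ.2.trans_lt (not_le.1 h)
      exact transfer_eq_zero (fun hτA => absurd (hαq.trans hτA.1.1.le) this.not_ge)
        fun hτB => absurd hτB.1.1 this.not_gt
    · have h1 := integral_transfer_eq_zero M.D_pos.le hA hB hAD hBD
      rw [← intervalIntegral.integral_add_adjacent_intervals (b := t)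
        (intervalIntegrable_of_integrableOn hin h0m ht)
        (intervalIntegrable_of_integrableOn hin ht hDm)] at h1
      have h2 : ∫ τ in t..M.D, transfer A B τ = 0 := by
        refine intervalIntegral.integral_zero_ae (ae_of_all _ fun τ hτ => ?_)
        rw [uIoc_of_le ht.2] at hτ
        have : δ < τ := (not_le.1 h).trans hτ.1
        exact transfer_eq_zero (fun hτA => absurd hτA.1.2 this.not_gt)
          fun hτB => absurd (hτB.1.2.le.trans hqδ) this.not_ge
      rwa [h2, add_zero] at h1
  have hH : ∀ t ∈ Icc 0 M.D, ∫ τ in (0 : ℝ)..t, M.a * Real.exp (M.b * τ) * transfer A B τ ≤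
      M.a * Real.exp (M.b * q) * K t := fun t ht => by
    rw [hK, ← intervalIntegral.integral_const_mul]
    refine intervalIntegral.integral_mono_on ht.1
      (intervalIntegrable_of_integrableOn (M.integrableOn_heat hin) h0m ht)
      ((intervalIntegrable_of_integrableOn hin h0m ht).const_mul _) fun τ _ => ?_
    rcases le_total τ q with h | h
    · exact mul_le_mul_of_nonneg_right (mul_le_mul_of_nonneg_left
        (Real.exp_le_exp.2 (mul_le_mul_of_nonneg_left h M.b_nonneg)) M.a_nonneg)
        (transfer_nonneg fun hτ => absurd hτ.1.1 h.not_gt)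
    · exact mul_le_mul_of_nonpos_right (mul_le_mul_of_nonneg_left
        (Real.exp_le_exp.2 (mul_le_mul_of_nonneg_left h M.b_nonneg)) M.a_nonneg)
        (transfer_nonpos fun hτ => absurd hτ.1.2 h.not_gt)
  set w := M.a * Real.exp (M.b * q) with hw
  have hw0 : 0 ≤ w := mul_nonneg M.a_nonneg (Real.exp_pos _).le
  -- The three bounds keep, in turn, the power on `A` nonnegative, the temperature constraint and
  -- the energy constraint.
  obtain ⟨ε, hε, hε1, hε2, hε3⟩ : ∃ ε > 0, ε * C ≤ c₂ ∧ ε * (w * (C * M.D)) ≤ η ∧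
      ε * (C * M.D) ≤ η := by
    have hc2 : 0 < c₂ := hc0.trans_lt hc
    have hL : ∀ L r : ℝ, 0 < r → ∀ᶠ ε in 𝓝[>] (0 : ℝ), ε * L ≤ r := fun L r hr => by
      exact nhdsWithin_le_nhds (((continuous_id.mul continuous_const).tendsto' 0 0
        (zero_mul L)).eventually_le_const hr)
    obtain ⟨ε, h⟩ := (((hL C c₂ hc2).and ((hL (w * (C * M.D)) η hη).and (hL (C * M.D) η hη))).and
      self_mem_nhdsWithin).exists
    exact ⟨ε, h.2, h.1.1, h.1.2.1, h.1.2.2⟩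
  have hk : (1 + c₂)⁻¹ < (1 + c₁)⁻¹ := inv_strictAnti₀ (by linarith) (by linarith)
  have hfe : M.IsFeasible fun t => P t + ε * transfer A B t := by
    refine hP.1.add_mul hin (fun t ht => ?_) (fun t ht => ?_) (fun t ht => ?_)
    · by_cases htA : t ∈ A
      · have h3 := mul_le_mul_of_nonneg_left (neg_le_of_abs_le (abs_transfer_le A B t)) hε.le
        have := htA.2
        rw [← hC] at h3
        linarith
      · exact add_nonneg (hP.1.nonneg t ht) (mul_nonneg hε.le (transfer_nonneg htA))
    · have h1 := mul_le_mul_of_nonneg_left (hH t ht) hε.le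
      by_cases hI : t ∈ Icc α δ
      · have h2 := mul_le_mul_of_nonneg_left (mul_le_mul_of_nonneg_left (hKle t ht) hw0) hε.le
        linarith [(hslack t hI).1]
      · rw [hK0 t ht hI, mul_zero, mul_zero] at h1
        linarith [hP.1.heatExcess_nonpos ht]
    · change (∫ τ in (0 : ℝ)..t, P τ) + ε * K t ≤ _
      by_cases hI : t ∈ Icc α δ
      · have h2 := mul_le_mul_of_nonneg_left (hKle t ht) hε.le
        linarith [(hslack t hI).2]
      · rw [hK0 t ht hI, mul_zero, add_zero]
        exact hP.1.causality t ht
  refine hP.not_isFeasible_add_transfer hA hB hAD hBD hA0 hB0 (φ := fun _ => 1)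
    (ε := ε) hk (fun t ht => ?_) (fun t ht => ?_) hε (by simpa only [one_mul] using hfe)
  · rw [one_div]
    exact inv_anti₀ (by linarith) (by linarith [ht.2])
  · rw [one_div]
    have := hP.1.nonneg t (Ioc_subset_Icc_self (hBD ht))
    exact inv_anti₀ (by linarith) (by linarith [ht.2])

/-- The interval is `Ico` because arrivals are counted strictly before the instant: one at `x`
counts for `y` but not for `x`, one at `y` for neither. -/
theorem energyBefore_le_of_notMem (M : HeatingTransmitter) {x y : ℝ}
    (h : ∀ t ∈ Ico x y, t ∉ range M.s) : M.energyBefore y ≤ M.energyBefore x := by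
  refine Finset.sum_le_sum_of_subset_of_nonneg ?_ fun i _ _ => M.E_nonneg i
  intro i hi
  simp only [Finset.mem_filter, Finset.mem_univ, true_and] at hi ⊢
  by_contra! hx
  exact h _ ⟨hx, hi⟩ (mem_range_self i)

theorem eventually_notMem_range_s (M : HeatingTransmitter) {t : ℝ} (ht : t ∉ range M.s) :
    ∀ᶠ x in 𝓝 t, x ∉ range M.s :=
  (finite_range M.s).isClosed.isOpen_compl.mem_nhds ht

theorem measure_ne_zero_of_ae {x y : ℝ} (hxy : x < y) {W : Set ℝ}
    (h : ∀ᵐ t, t ∈ Ioo x y → t ∈ W) : volume W ≠ 0 := by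
  intro h0
  have : volume (Ioo x y) ≤ volume W := measure_mono_ae h
  rw [h0, Real.volume_Ioo] at this
  simp [hxy.not_ge] at this

theorem exists_mem_of_ae {x y : ℝ} (hxy : x < y) {W : Set ℝ} (h : ∀ᵐ t, t ∈ Ioo x y → t ∈ W) :
    ∃ t ∈ Ioo x y, t ∈ W :=
  nonempty_of_measure_ne_zero (measure_ne_zero_of_ae hxy (W := Ioo x y ∩ W)
    (h.mono fun _ ht hI => ⟨hI, ht hI⟩))

theorem IsOptimal.le_of_slack (hP : M.IsOptimal P) (hm : Measurable P)
    {α β γ δ c₁ c₂ : ℝ} (hα : 0 ≤ α) (hαβ : α < β) (hβγ : β ≤ γ) (hγδ : γ < δ) (hδ : δ ≤ M.D)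
    (hE : M.energyBefore δ ≤ M.energyBefore α)
    (hs : ∀ t ∈ Icc α δ, M.heatExcess P t < 0 ∧ ∫ τ in (0 : ℝ)..t, P τ < M.energyBefore t)
    (h₁ : ∀ᵐ t, t ∈ Ioo α β → P t ≤ c₁) (h₂ : ∀ᵐ t, t ∈ Ioo γ δ → c₂ ≤ P t) : c₂ ≤ c₁ := by
  by_contra! hc
  rcases hP.null_or_null_of_slack hm hα hαβ.le (hβγ.trans hγδ.le) hδ hE hs hc with h | h
  · exact measure_ne_zero_of_ae hαβ (W := {t | t ∈ Ioo α β ∧ P t ≤ c₁})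
      (h₁.mono fun t ht hI => ⟨hI, ht hI⟩) h
  · exact measure_ne_zero_of_ae hγδ (W := {t | t ∈ Ioo β δ ∧ c₂ ≤ P t})
      (h₂.mono fun t ht hI => ⟨⟨hβγ.trans_lt hI.1, hI.2⟩, ht hI⟩) h

theorem heatExcess_neg_of_a_eq_zero (ha : M.a = 0) (P : ℝ → ℝ) (t : ℝ) :
    M.heatExcess P t < 0 := by
  have := mul_pos M.Tdelta_pos (Real.exp_pos (M.b * t))
  simpa [heatExcess, ha] using this

/-- An optimal policy does not jump up between energy arrivals. -/
theorem IsOptimal.le_of_not_arrival (hP : M.IsOptimal P) (hm : Measurable P)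
    {α t δ c₁ c₂ : ℝ} (hα : 0 ≤ α) (hαt : α < t) (htδ : t < δ) (hδ : δ ≤ M.D)
    (ht : t ∉ range M.s) (h₁ : ∀ᵐ τ, τ ∈ Ioo α t → P τ ≤ c₁)
    (h₂ : ∀ᵐ τ, τ ∈ Ioo t δ → c₂ ≤ P τ) : c₂ ≤ c₁ := by
  have hα' : ∀ x, α ≤ x → ∀ᵐ τ, τ ∈ Ioo x t → P τ ≤ c₁ := fun x hx =>
    h₁.mono fun τ hτ hI => hτ ⟨hx.trans_lt hI.1, hI.2⟩
  have hδ' : ∀ y, y ≤ δ → ∀ᵐ τ, τ ∈ Ioo t y → c₂ ≤ P τ := fun y hy =>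
    h₂.mono fun τ hτ hI => hτ ⟨hI.1, hI.2.trans_le hy⟩
  have htI : t ∈ Ioo 0 M.D := ⟨hα.trans_lt hαt, htδ.trans_le hδ⟩
  have htm : t ∈ Icc 0 M.D := Ioo_subset_Icc_self htI
  have hnhds : Icc 0 M.D ∈ 𝓝 t := Icc_mem_nhds htI.1 htI.2
  have hev := (M.eventually_notMem_range_s ht).and (Ioo_mem_nhds hαt htδ)
  by_contra! hc
  obtain ⟨z, hz, hzc⟩ := exists_mem_of_ae hαt h₁
  have hc₁ : 0 ≤ c₁ := (hP.1.nonneg z ⟨hα.trans hz.1.le, hz.2.le.trans htm.2⟩).trans hzc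
  have hf : M.heatExcess P t < 0 := by
    rcases M.a_nonneg.eq_or_lt with ha | ha
    · exact heatExcess_neg_of_a_eq_zero ha.symm P t
    refine lt_of_le_of_ne (hP.1.heatExcess_nonpos htm) fun h0 => ?_
    have e1 := hP.1.le_of_heatExcess_eq_zero_left hα hαt htm.2 h0 h₁
    have e2 := hP.1.le_of_heatExcess_eq_zero_right htm.1 htδ hδ h0 h₂
    exact hc.not_ge (le_of_mul_le_mul_left (e2.trans e1) ha)
  have hg : ∫ τ in (0 : ℝ)..t, P τ < M.energyBefore t := by
    refine lt_of_le_of_ne (hP.1.causality t htm) fun h0 => ?_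
    obtain ⟨l, u, hlu, hsub⟩ := mem_nhds_iff_exists_Ioo_subset.1 hev
    obtain ⟨y, hy⟩ := exists_between hlu.2
    have hyδ : y ≤ δ := (hsub ⟨hlu.1.trans hy.1, hy.2⟩).2.2.le
    have := hP.1.nonpos_of_energy_eq htm.1 hy.1 (hyδ.trans hδ) h0
      (M.energyBefore_le_of_notMem fun x hx =>
        (hsub ⟨hlu.1.trans_le hx.1, hx.2.trans hy.2⟩).1) (hδ' y hyδ)
    linarith
  -- Both constraints are strict at `t`; continuity makes them slack on a neighbourhood, where
  -- `le_of_slack` forbids the rise.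
  have hfc : ContinuousAt (M.heatExcess P) t :=
    (((continuousOn_integral M.D_pos.le (M.integrableOn_heat hP.1.integrable)).continuousAt
      hnhds).sub (by fun_prop))
  have hgc : ContinuousAt (fun t => ∫ τ in (0 : ℝ)..t, P τ) t :=
    (continuousOn_integral M.D_pos.le hP.1.integrable).continuousAt hnhds
  obtain ⟨l, u, hlu, hsub⟩ := mem_nhds_iff_exists_Ioo_subset.1
    (hev.and ((hfc.eventually_lt_const hf).and (hgc.eventually_lt_const hg)))
  obtain ⟨x, hx⟩ := exists_between hlu.1
  obtain ⟨y, hy⟩ := exists_between hlu.2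
  have hxα := (hsub ⟨hx.1, hx.2.trans hlu.2⟩).1.2.1.le
  have hyδ := (hsub ⟨hlu.1.trans hy.1, hy.2⟩).1.2.2.le
  have hxy : ∀ τ ∈ Icc x y, τ ∈ Ioo l u := fun τ hτ => ⟨hx.1.trans_le hτ.1, hτ.2.trans_lt hy.2⟩
  have hA : ∀ v w, x ≤ v → w ≤ y → M.energyBefore w ≤ M.energyBefore v := fun v w hv hw =>
    M.energyBefore_le_of_notMem fun τ hτ => (hsub (hxy τ ⟨hv.trans hτ.1, hτ.2.le.trans hw⟩)).1.1
  refine hc.not_ge (hP.le_of_slack hm (hα.trans hxα) hx.2 le_rfl hy.1 (hyδ.trans hδ)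
    (hA x y le_rfl le_rfl) (fun τ hτ => ?_) (hα' x hxα) (hδ' y hyδ))
  have h3 := (hsub (hxy τ hτ)).2
  exact ⟨h3.1, h3.2.trans_le (hA τ t hτ.1 hy.1.le)⟩

/-! ### A monotone version of the scaled power -/

/-- The scaled power of an optimal policy is nondecreasing off a null set. -/
theorem IsOptimal.exists_monotoneOn (hP : M.IsOptimal P) (hm : Measurable P) :
    ∃ S ⊆ Ioo 0 M.D, MonotoneOn (M.scaledPower P) S ∧ ∀ᵐ t, t ∈ Ioo 0 M.D → t ∈ S := by
  set A : ℝ → ℝ → Set ℝ := fun q c => {t | t ∈ Ioo 0 q ∧ c ≤ M.scaledPower P t} with hA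
  set B : ℝ → ℝ → Set ℝ := fun q c => {t | t ∈ Ioo q M.D ∧ M.scaledPower P t ≤ c} with hB
  -- Only countably many null level sets are removed: a violation of monotonicity can be separated
  -- by rational `q` and `c < c'`.
  refine ⟨{t | t ∈ Ioo 0 M.D ∧ ∀ q c : ℚ, (volume (A q c) = 0 → t ∉ A q c) ∧
    (volume (B q c) = 0 → t ∉ B q c)}, fun t ht => ht.1, ?_, ?_⟩
  · intro x hx y hy hxy
    by_contra! hlt
    have hne : x ≠ y := by rintro rfl; exact lt_irrefl _ hlt
    obtain ⟨q, hq⟩ := exists_rat_btwn (hxy.lt_of_ne hne)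
    obtain ⟨c, hc⟩ := exists_rat_btwn hlt
    obtain ⟨c', hc'⟩ := exists_rat_btwn hc.2
    rcases hP.scaledPower_null_or_null hm (q := q) (c := c) (c' := c')
      ⟨hx.1.1.le.trans hq.1.le, hq.2.le.trans hy.1.2.le⟩ hc'.1 with h | h
    · exact (hx.2 q c').1 h ⟨⟨hx.1.1, hq.1⟩, hc'.2.le⟩
    · exact (hy.2 q c).2 h ⟨⟨hq.2, hy.1.2⟩, hc.1.le⟩
  · have : ∀ᵐ t, ∀ q c : ℚ, (volume (A q c) = 0 → t ∉ A q c) ∧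
        (volume (B q c) = 0 → t ∉ B q c) := by
      refine ae_all_iff.2 fun q => ae_all_iff.2 fun c => Eventually.and ?_ ?_
      · by_cases h : volume (A q c) = 0
        · exact (measure_eq_zero_iff_ae_notMem.1 h).mono fun t ht _ => ht
        · exact ae_of_all _ fun t h' => absurd h' h
      · by_cases h : volume (B q c) = 0
        · exact (measure_eq_zero_iff_ae_notMem.1 h).mono fun t ht _ => ht
        · exact ae_of_all _ fun t h' => absurd h' h
    exact this.mono fun t ht hI => ⟨hI, ht⟩

/-- The scaled power of an optimal policy is essentially bounded. -/
theorem IsOptimal.bddAbove_scaledPower (hP : M.IsOptimal P) (hm : Measurable P) {S : Set ℝ}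
    (hSD : S ⊆ Ioo 0 M.D) (hmono : MonotoneOn (M.scaledPower P) S)
    (hS : ∀ᵐ t, t ∈ Ioo 0 M.D → t ∈ S) : BddAbove (M.scaledPower P '' S) := by
  -- By monotonicity `P` would tend to infinity at `D` along `S`. Beyond the last arrival, high
  -- power to the right of every instant keeps both constraints slack, so `P` could not rise.
  by_contra hub
  have hdense : ∀ x y, 0 ≤ x → x < y → y ≤ M.D → ∃ t ∈ Ioo x y, t ∈ S := fun x y hx hxy hy =>
    exists_mem_of_ae hxy (hS.mono fun t ht hI => ht ⟨hx.trans_lt hI.1, hI.2.trans_le hy⟩)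
  have hlarge : ∀ K x, 0 ≤ x → x < M.D → ∃ s ∈ S, x < s ∧ ∀ τ ∈ S, s ≤ τ → K ≤ P τ := by
    intro K x hx hxD
    obtain ⟨s₁, hs₁, hs₁S⟩ := hdense x M.D hx hxD le_rfl
    obtain ⟨_, ⟨s, hs, rfl⟩, hlt⟩ := not_bddAbove_iff.1 hub
      (max (M.scaledPower P s₁) (Real.exp (M.b * M.D) * (1 + K)))
    have h1 := max_lt_iff.1 hlt
    refine ⟨s, hs, hs₁.1.trans ?_, fun τ hτ hsτ => ?_⟩
    · by_contra! hle
      exact h1.1.not_ge (hmono hs hs₁S hle)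
    · have hτD := hSD hτ
      have h2 := h1.2.trans_le (hmono hs hτ hsτ)
      have h3 : M.scaledPower P τ ≤ Real.exp (M.b * M.D) * (1 + P τ) :=
        mul_le_mul_of_nonneg_right
          (Real.exp_le_exp.2 (mul_le_mul_of_nonneg_left hτD.2.le M.b_nonneg))
          (by linarith [hP.1.nonneg τ (Ioo_subset_Icc_self hτD)])
      linarith [lt_of_mul_lt_mul_left (h2.trans_le h3) (Real.exp_pos _).le]
  have hlarge' : ∀ K s y, 0 ≤ s → y ≤ M.D → (∀ τ ∈ S, s ≤ τ → K ≤ P τ) →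
      ∀ᵐ τ, τ ∈ Ioo s y → K ≤ P τ := fun K s y hs hy h =>
    hS.mono fun τ hτ hI => h τ (hτ ⟨hs.trans_lt hI.1, hI.2.trans_le hy⟩) hI.1.le
  obtain ⟨d, hdD, hd⟩ := mem_nhdsLT_iff_exists_Ioo_subset.1 (inter_mem
    (mem_nhdsWithin_of_mem_nhds (M.eventually_notMem_range_s (t := M.D)
      (by rintro ⟨k, hk⟩; exact (M.s_lt_D k).ne hk)))
    (mem_nhdsWithin_of_mem_nhds (Ioi_mem_nhds M.D_pos)))
  obtain ⟨d', hd'⟩ := exists_between (show d < M.D from hdD)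
  have hA : ∀ v, d' ≤ v → M.energyBefore M.D ≤ M.energyBefore v := fun v hv =>
    M.energyBefore_le_of_notMem fun τ hτ => (hd ⟨hd'.1.trans_le (hv.trans hτ.1), hτ.2⟩).1
  have hd0 : 0 ≤ d' := (hd hd').2.le
  have hbT : 0 ≤ M.b * M.Tdelta := mul_nonneg M.b_nonneg M.Tdelta_pos.le
  -- Power above `b T_δ / a` excludes a tight temperature constraint, and the `+ 1` also gives
  -- positivity. If `a = 0` the quotient is `0` and that constraint is never tight.
  obtain ⟨t₀, ht₀, hdt₀, h₀⟩ := hlarge (M.b * M.Tdelta / M.a + 1) d' hd0 hd'.2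
  have ht₀D := hSD ht₀
  obtain ⟨t₁, ht₁, ht₁S⟩ := hdense t₀ M.D ht₀D.1.le ht₀D.2 le_rfl
  -- Since `e^{bτ} ≥ 1`, monotonicity gives `P ≤ scaledPower P t₁ - 1` a.e. on `(t₀, t₁)`; power at
  -- least `scaledPower P t₁` after `t₂` is a forbidden rise.
  obtain ⟨t₂, ht₂, ht₁₂, h₂⟩ := hlarge (M.scaledPower P t₁) t₁ (hSD ht₁S).1.le ht₁.2
  have ht₂D := hSD ht₂
  obtain ⟨δ, hδ⟩ := exists_between ht₂D.2
  have hle := hP.le_of_slack hm (c₁ := M.scaledPower P t₁ - 1) ht₀D.1.le ht₁.1 ht₁₂.le hδ.1 hδ.2.le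
    ((M.energyBefore_mono hδ.2.le).trans (hA t₀ hdt₀.le)) (fun t ht => ?_)
    (hS.mono fun τ hτ hI => ?_) (hlarge' _ t₂ δ ht₂D.1.le hδ.2.le h₂)
  · linarith
  · have htD : t < M.D := ht.2.trans_lt hδ.2
    have ht0 : 0 ≤ t := ht₀D.1.le.trans ht.1
    have hPt := hlarge' _ t M.D ht0 le_rfl fun τ hτ hle => h₀ τ hτ (ht.1.trans hle)
    have hc : 0 ≤ M.b * M.Tdelta / M.a := div_nonneg hbT M.a_nonneg
    constructor
    · rcases M.a_nonneg.eq_or_lt with ha | ha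
      · exact heatExcess_neg_of_a_eq_zero ha.symm P t
      refine lt_of_le_of_ne (hP.1.heatExcess_nonpos ⟨ht0, htD.le⟩) fun h0 => ?_
      have := hP.1.le_of_heatExcess_eq_zero_right ht0 htD le_rfl h0 hPt
      rw [mul_add, mul_div_cancel₀ _ ha.ne'] at this
      linarith
    · refine lt_of_le_of_ne (hP.1.causality t ⟨ht0, htD.le⟩) fun h0 => ?_
      have := hP.1.nonpos_of_energy_eq ht0 htD le_rfl h0 (hA t (hdt₀.le.trans ht.1)) hPt
      linarith
  · have hτD : τ ∈ Ioo 0 M.D := ⟨ht₀D.1.trans hI.1, hI.2.trans ht₁.2⟩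
    have h1 := hmono (hτ hτD) ht₁S hI.2.le
    have h2 : 1 * (1 + P τ) ≤ M.scaledPower P τ := mul_le_mul_of_nonneg_right
      (Real.one_le_exp (mul_nonneg M.b_nonneg hτD.1.le))
      (by linarith [hP.1.nonneg τ (Ioo_subset_Icc_self hτD)])
    linarith

/-- An optimal policy agrees almost everywhere with `e^{-bt} G(t) - 1` for a monotone `G`. -/
theorem IsOptimal.exists_monotone (hP : M.IsOptimal P) (hm : Measurable P) :
    ∃ G : ℝ → ℝ, Monotone G ∧ (∀ t, Real.exp (M.b * t) ≤ G t) ∧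
      ∀ᵐ t, t ∈ Ioo 0 M.D → P t = Real.exp (-M.b * t) * G t - 1 := by
  obtain ⟨S, hSD, hmono, hS⟩ := hP.exists_monotoneOn hm
  have hexp : ∀ t ∈ S, Real.exp (M.b * t) ≤ M.scaledPower P t := fun t ht =>
    le_mul_of_one_le_right (Real.exp_pos _).le
      (by linarith [hP.1.nonneg t (Ioo_subset_Icc_self (hSD ht))])
  obtain ⟨g, hg, hgS⟩ := hmono.exists_monotone_extension
    ⟨0, by rintro _ ⟨t, ht, rfl⟩; exact (Real.exp_pos _).le.trans (hexp t ht)⟩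
    (hP.bddAbove_scaledPower hm hSD hmono hS)
  -- The maximum changes nothing on `S` and makes the resulting policy nonnegative everywhere.
  refine ⟨fun t => max (g t) (Real.exp (M.b * t)), fun x y hxy => max_le_max (hg hxy)
    (Real.exp_le_exp.2 (mul_le_mul_of_nonneg_left hxy M.b_nonneg)), fun t => le_max_right _ _,
    hS.mono fun t ht hI => ?_⟩
  have htS := ht hI
  simp only
  rw [← hgS htS, max_eq_left (hexp t htS), scaledPower, ← mul_assoc, ← Real.exp_add]
  simp

/-! ### The modified policy and its jumps -/

/-- The policy `e^{-bt} G(t) - 1`, made continuous at both ends of `[0, D]`. -/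
noncomputable def policyOf (M : HeatingTransmitter) (G : ℝ → ℝ) (t : ℝ) : ℝ :=
  Real.exp (-M.b * t) *
    (if t ≤ 0 then G.rightLim t else if M.D ≤ t then G.leftLim t else G t) - 1

theorem policyOf_eq {G : ℝ → ℝ} {t : ℝ} (ht : t ∈ Ioo 0 M.D) :
    M.policyOf G t = Real.exp (-M.b * t) * G t - 1 := by
  simp [policyOf, ht.1.not_ge, ht.2.not_ge]

section policyOf

variable {G : ℝ → ℝ} {t : ℝ}

theorem policyOf_nonneg (hG : Monotone G) (hexp : ∀ t, Real.exp (M.b * t) ≤ G t) (t : ℝ) :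
    0 ≤ M.policyOf G t := by
  have hl : Real.exp (M.b * t) ≤ G.leftLim t := by
    have hc : Tendsto (fun x => Real.exp (M.b * x)) (𝓝[<] t) (𝓝 (Real.exp (M.b * t))) :=
      ((by fun_prop : Continuous fun x => Real.exp (M.b * x)).tendsto t).mono_left
        nhdsWithin_le_nhds
    exact le_of_tendsto_of_tendsto' hc (hG.tendsto_leftLim t) hexp
  have h : Real.exp (M.b * t) ≤
      if t ≤ 0 then G.rightLim t else if M.D ≤ t then G.leftLim t else G t := by
    split_ifs
    exacts [(hexp t).trans (hG.le_rightLim le_rfl), hl, hexp t]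
  have := mul_le_mul_of_nonneg_left h (Real.exp_pos (-M.b * t)).le
  rw [← Real.exp_add, neg_mul, neg_add_cancel, Real.exp_zero] at this
  rw [policyOf, neg_mul]
  linarith

theorem tendsto_policyOf_left (hG : Monotone G) (ht : t ∈ Ioc 0 M.D) :
    Tendsto (M.policyOf G) (𝓝[<] t) (𝓝 (Real.exp (-M.b * t) * G.leftLim t - 1)) := by
  have hc : Tendsto (fun x => Real.exp (-M.b * x)) (𝓝[<] t) (𝓝 (Real.exp (-M.b * t))) :=
    ((by fun_prop : Continuous fun x => Real.exp (-M.b * x)).tendsto t).mono_left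
      nhdsWithin_le_nhds
  refine ((hc.mul (hG.tendsto_leftLim t)).sub_const 1).congr' ?_
  filter_upwards [Ioo_mem_nhdsLT ht.1] with x hx
  exact (policyOf_eq ⟨hx.1, hx.2.trans_le ht.2⟩).symm

theorem tendsto_policyOf_right (hG : Monotone G) (ht : t ∈ Ico 0 M.D) :
    Tendsto (M.policyOf G) (𝓝[>] t) (𝓝 (Real.exp (-M.b * t) * G.rightLim t - 1)) := by
  have hc : Tendsto (fun x => Real.exp (-M.b * x)) (𝓝[>] t) (𝓝 (Real.exp (-M.b * t))) :=
    ((by fun_prop : Continuous fun x => Real.exp (-M.b * x)).tendsto t).mono_left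
      nhdsWithin_le_nhds
  refine ((hc.mul (hG.tendsto_rightLim t)).sub_const 1).congr' ?_
  filter_upwards [Ioo_mem_nhdsGT ht.2] with x hx
  exact (policyOf_eq ⟨ht.1.trans_lt hx.1, hx.2⟩).symm

theorem continuousWithinAt_policyOf_zero (hG : Monotone G) :
    ContinuousWithinAt (M.policyOf G) (Icc 0 M.D) 0 := by
  refine (continuousWithinAt_Ioi_iff_Ici.1 ?_).mono Icc_subset_Ici_self
  have := tendsto_policyOf_right (M := M) hG ⟨le_rfl, M.D_pos⟩
  simpa [ContinuousWithinAt, policyOf] using this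

theorem continuousWithinAt_policyOf_D (hG : Monotone G) :
    ContinuousWithinAt (M.policyOf G) (Icc 0 M.D) M.D := by
  refine (continuousWithinAt_Iio_iff_Iic.1 ?_).mono Icc_subset_Iic_self
  have := tendsto_policyOf_left (M := M) hG ⟨M.D_pos, le_rfl⟩
  simpa [ContinuousWithinAt, policyOf, M.D_pos.not_ge] using this

theorem leftLim_lt_rightLim_of_not_continuousAt (hG : Monotone G) (ht : t ∈ Ioo 0 M.D)
    (h : ¬ContinuousAt (M.policyOf G) t) : G.leftLim t < G.rightLim t := by
  refine lt_of_le_of_ne (hG.leftLim_le_rightLim le_rfl) fun heq => h ?_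
  have hc : ContinuousAt G t := hG.continuousAt_iff_leftLim_eq_rightLim.2 heq
  have : ContinuousAt (fun x => Real.exp (-M.b * x) * G x - 1) t :=
    ((by fun_prop : ContinuousAt (fun x => Real.exp (-M.b * x)) t).mul hc).sub continuousAt_const
  refine this.congr ?_
  filter_upwards [Ioo_mem_nhds ht.1 ht.2] with x hx
  exact (policyOf_eq hx).symm

end policyOf

end HeatingTransmitter

theorem lemma7 (M : HeatingTransmitter) (P : ℝ → ℝ) (hP : M.IsOptimal P) :
    (∃ P' : ℝ → ℝ, P' =ᵐ[volume.restrict (Icc 0 M.D)] P ∧ M.IsOptimal P' ∧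
      ∀ t ∈ Icc 0 M.D, ¬ ContinuousWithinAt P' (Icc 0 M.D) t →
        M.IsArrival t ∧ HasPositiveJumpAt P' t) ∧
    ContinuousOn (M.temperature P) (Icc 0 M.D) := by
  refine ⟨?_, hP.1.continuousOn_temperature⟩
  obtain ⟨Q, hQm, hQ0, hPQ⟩ := hP.1.exists_measurable
  have hQ : M.IsOptimal Q := hP.congr_ae hPQ fun t _ => hQ0 t
  obtain ⟨G, hG, hexp, hQG⟩ := hQ.exists_monotone hQm
  have hQG' : ∀ᵐ t, t ∈ Ioo 0 M.D → Q t = M.policyOf G t :=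
    hQG.mono fun t ht hI => (ht hI).trans (HeatingTransmitter.policyOf_eq hI).symm
  have hae : Q =ᵐ[volume.restrict (Icc 0 M.D)] M.policyOf G := by
    rw [← restrict_Ioo_eq_restrict_Icc]
    exact (ae_restrict_iff' measurableSet_Ioo).2 hQG'
  refine ⟨M.policyOf G, (hPQ.trans hae).symm,
    hQ.congr_ae hae fun t _ => HeatingTransmitter.policyOf_nonneg hG hexp t, fun t ht hdisc => ?_⟩
  have ht0 : t ≠ 0 := by
    rintro rfl
    exact hdisc (HeatingTransmitter.continuousWithinAt_policyOf_zero hG)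
  have htD : t ≠ M.D := by
    rintro rfl
    exact hdisc (HeatingTransmitter.continuousWithinAt_policyOf_D hG)
  have htI : t ∈ Ioo 0 M.D := ⟨ht.1.lt_of_ne' ht0, ht.2.lt_of_ne htD⟩
  have hlt := HeatingTransmitter.leftLim_lt_rightLim_of_not_continuousAt hG htI fun h => hdisc h.continuousWithinAt
  have hl := HeatingTransmitter.tendsto_policyOf_left hG ⟨htI.1, htI.2.le⟩
  have hr := HeatingTransmitter.tendsto_policyOf_right hG ⟨htI.1.le, htI.2⟩
  have hjump : Real.exp (-M.b * t) * G.leftLim t - 1 < Real.exp (-M.b * t) * G.rightLim t - 1 :=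
    sub_lt_sub_right (mul_lt_mul_of_pos_left hlt (Real.exp_pos _)) 1
  refine ⟨?_, _, _, hjump, hl, hr, ?_⟩
  · by_contra harr
    have hts : t ∉ range M.s := by
      rintro ⟨k, hk⟩
      refine harr ⟨k, ?_, hk.symm⟩
      rintro rfl
      exact ht0 (hk.symm.trans M.s_zero)
    -- Two levels strictly inside the jump: near `t` the policy is at most `c₁` on the left and at
    -- least `c₂ > c₁` on the right.
    obtain ⟨c₁, h1, h2⟩ := exists_between hjump
    obtain ⟨c₂, h3, h4⟩ := exists_between h2
    obtain ⟨α', hα', hαs⟩ := mem_nhdsLT_iff_exists_Ioo_subset.1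
      (inter_mem (hl.eventually_le_const h1) (Ioo_mem_nhdsLT htI.1))
    obtain ⟨δ', hδ', hδs⟩ := mem_nhdsGT_iff_exists_Ioo_subset.1
      (inter_mem (hr.eventually_const_le h4) (Ioo_mem_nhdsGT htI.2))
    obtain ⟨α, hαα, hα⟩ := exists_between (mem_Iio.1 hα')
    obtain ⟨δ, hδ, hδδ⟩ := exists_between (mem_Ioi.1 hδ')
    have hα0 : 0 < α := (hαs ⟨hαα, hα⟩).2.1
    have hδD : δ < M.D := (hδs ⟨hδ, hδδ⟩).2.2
    refine h3.not_ge (hQ.le_of_not_arrival hQm hα0.le hα hδ hδD.le hts ?_ ?_)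
    · filter_upwards [hQG'] with τ hτ hI
      rw [hτ ⟨hα0.trans hI.1, hI.2.trans htI.2⟩]
      exact (hαs ⟨hαα.trans hI.1, hI.2⟩).1
    · filter_upwards [hQG'] with τ hτ hI
      rw [hτ ⟨htI.1.trans hI.1, hI.2.trans hδD⟩]
      exact (hδs ⟨hI.1, hI.2.trans hδδ⟩).1
  · rw [HeatingTransmitter.policyOf_eq htI]
    have e := (Real.exp_pos (-M.b * t)).le
    exact ⟨sub_le_sub_right (mul_le_mul_of_nonneg_left (hG.leftLim_le le_rfl) e) 1,
      sub_le_sub_right (mul_le_mul_of_nonneg_left (hG.le_rightLim le_rfl) e) 1⟩
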